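/- Let $0<q<1$, let $N,n,k$ be integers with $1\le k\le n-1$ and $n\le N$, and let $\alpha,\beta,\gamma,\delta$ be real. Write $(a;q)_m=\prod_{j=0}^{m-1}(1-aq^j)$, $(a_1,\dots,a_r;q)_m=\prod_i (a_i;q)_m$, $\mu(x)=q^{-x}+\gamma\delta q^{x+1}$, let $$w(x)=\frac{(\alpha q,\beta\delta q,\gamma q,\gamma\delta q;q)_x\,(1-\gamma\delta q^{2x+1})}{\big(q,\tfrac{\gamma\delta q}{\alpha},\tfrac{\gamma q}{\beta},\delta q;q\big)_x(\alpha\beta q)^x(1-\gamma\delta q)},\qquad x\in\{0,1,\dots,N\},$$ and let $\tilde R_n(\,\cdot\,;\alpha,\beta,\gamma,\delta|q)$ be the monic $q$-Racah polynomial, i.e. the polynomial of degree $n$ in the variable $\mu(x)$ given by $$\tilde R_n(\mu(x);\alpha,\beta,\gamma,\delta|q)=\frac{(\alpha q,\beta\delta q,\gamma q;q)_n}{(\alpha\beta q^{n+1};q)_n}\sum_{m=0}^{n}\frac{(q^{-n},\alpha\beta q^{n+1},q^{-x},\gamma\delta q^{x+1};q)_m}{(\alpha q,\beta\delta q,\gamma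 q,q;q)_m}\,q^m .$$ Consider the two cases (i) $\alpha=q^{-N-1}$ and $Q(y)=\tilde R_n\big(y;\tfrac{\alpha}{q^k},\beta,\gamma,\delta|q\big)$; (ii) $\delta\ne0$, $\beta=\dfrac{q^{-N-1}}{\delta}$ and $Q(y)=\tilde R_n\big(y;\alpha,\tfrac{\beta}{q^k},\gamma,\delta|q\big)$. Assume that the points $\mu(0),\dots,\mu(N)$ are distinct, that $w(0),\dots,w(N)$ (formed with the unshifted parameters) are well defined and nonzero, and that $\alpha\beta q^j\neq1$ for $2\le j\le 2N$ (so that all polynomials involved are well defined). Then in each of the two cases: (a) $Q$ has exact degree $n$ and $\sum_{x=0}^{N}\mu(x)^mQ(\mu(x))w(x)=0$ for all $m\in\{0,1,\dots,n-k-1\}$. If moreover $\beta q^n\ne1$ in case (i), respectively $\alpha q^n\neq\delta$ in case (ii), then $\sum_{x=0}^{N}\mu(x)^{n-k}Q(\mu(x))w(x)\neq0$, so that $Q$ is discrete quasi-orthogonal of order exactly $k$ with respect to the weight $w$ on $\{\mu(0),\dots,\mu(N)\}$. (b) If moreover $w(x)>0$ for $x\in\{0,\dots,N\}$ and $\mu(0)<\mu(1)<\dots<\mu(N)$,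 then $Q$ has at least $n-k$ distinct real zeros in the open interval $(\mu(0),\mu(N))$. -/

import Mathlib

open Polynomial

/-- The `q`-Pochhammer symbol `(a; q)_m = ∏_{j < m} (1 - a q^j)`. -/
noncomputable def qPoch (a q : ℝ) (m : ℕ) : ℝ :=
  ∏ j ∈ Finset.range m, (1 - a * q ^ j)

/-- The lattice `μ(x) = q^{-x} + γ δ q^{x+1}` at the nonnegative integers. -/
noncomputable def qRacahNode (q γ δ : ℝ) (x : ℕ) : ℝ :=
  (q ^ x)⁻¹ + γ * δ * q ^ (x + 1)

/-- The `q`-Racah weight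
`(αq, βδq, γq, γδq; q)_x (1 - γδq^{2x+1}) /
  ((q, γδq/α, γq/β, δq; q)_x (αβq)^x (1 - γδq))`. -/
noncomputable def qRacahWeight (q α β γ δ : ℝ) (x : ℕ) : ℝ :=
  (qPoch (α * q) q x * qPoch (β * δ * q) q x * qPoch (γ * q) q x * qPoch (γ * δ * q) q x
      * (1 - γ * δ * q ^ (2 * x + 1))) /
    (qPoch q q x * qPoch (γ * δ * q / α) q x * qPoch (γ * q / β) q x * qPoch (δ * q) q x
      * (α * β * q) ^ x * (1 - γ * δ * q))

/-- The basis polynomial `∏_{j < m} (1 - q^j y + γδ q^{2j+1})` in the lattice variable `y`;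
at `y = q^{-x} + γδ q^{x+1}` it equals `(q^{-x}; q)_m (γδ q^{x+1}; q)_m`. -/
noncomputable def qRacahBasis (q γ δ : ℝ) (m : ℕ) : ℝ[X] :=
  ∏ j ∈ Finset.range m, (C (1 + γ * δ * q ^ (2 * j + 1)) - C (q ^ j) * X)

/-- The monic `q`-Racah polynomial of degree `n`, as a polynomial in the lattice variable:
`(αq, βδq, γq; q)_n / (αβq^{n+1}; q)_n` times the terminating `₄φ₃` series. -/
noncomputable def qRacahPoly (q : ℝ) (n : ℕ) (α β γ δ : ℝ) : ℝ[X] :=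
  C (qPoch (α * q) q n * qPoch (β * δ * q) q n * qPoch (γ * q) q n
      / qPoch (α * β * q ^ (n + 1)) q n) *
    ∑ m ∈ Finset.range (n + 1),
      C (qPoch ((q ^ n)⁻¹) q m * qPoch (α * β * q ^ (n + 1)) q m
          / (qPoch (α * q) q m * qPoch (β * δ * q) q m * qPoch (γ * q) q m * qPoch q q m)
          * q ^ m) * qRacahBasis q γ δ m

theorem qRacahBasis_eval (q γ δ t : ℝ) (ht : t ≠ 0) (m : ℕ) :
    (qRacahBasis q γ δ m).eval (t + γ * δ * q / t)
      = qPoch t q m * qPoch (γ * δ * q / t) q m := by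
  unfold qRacahBasis qPoch
  rw [eval_prod, ← Finset.prod_mul_distrib]
  refine Finset.prod_congr rfl fun j _ => ?_
  simp only [eval_sub, eval_mul, eval_C, eval_X]
  field_simp
  ring

/-- With `t = q^{-x}` (so that `t + γδq/t = μ(x)`), the polynomial takes the values given by the
`₄φ₃` formula. -/
theorem qRacahPoly_eval (q : ℝ) (n : ℕ) (α β γ δ t : ℝ) (ht : t ≠ 0) :
    (qRacahPoly q n α β γ δ).eval (t + γ * δ * q / t)
      = qPoch (α * q) q n * qPoch (β * δ * q) q n * qPoch (γ * q) q n
          / qPoch (α * β * q ^ (n + 1)) q n *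
        ∑ m ∈ Finset.range (n + 1),
          qPoch ((q ^ n)⁻¹) q m * qPoch (α * β * q ^ (n + 1)) q m * qPoch t q m
              * qPoch (γ * δ * q / t) q m
            / (qPoch (α * q) q m * qPoch (β * δ * q) q m * qPoch (γ * q) q m)
            * (q ^ m / qPoch q q m) := by
  unfold qRacahPoly
  rw [eval_mul, eval_C, eval_finsetSum]
  congr 1
  refine Finset.sum_congr rfl fun m _ => ?_
  rw [eval_mul, eval_C, qRacahBasis_eval q γ δ t ht]
  simp only [div_eq_mul_inv, mul_inv]
  ring

/-- The `m`-th moment `∑_{x=0}^{N} μ(x)^m Q(μ(x)) w(x)` of a polynomial `Q`. -/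
noncomputable def discreteMoment (N : ℕ) (μ w : ℕ → ℝ) (Q : ℝ[X]) (m : ℕ) : ℝ :=
  ∑ x ∈ Finset.range (N + 1), μ x ^ m * Q.eval (μ x) * w x

/-- `Q` has exact degree `n`, and its moments of order `0, …, n - k - 1` vanish. -/
structure IsWeakQuasiOrthogonal (N : ℕ) (μ w : ℕ → ℝ) (n k : ℕ) (Q : ℝ[X]) : Prop where
  natDegree_eq : Q.natDegree = n
  moment_eq_zero : ∀ m : ℕ, m + k < n → discreteMoment N μ w Q m = 0

/-- Discrete quasi-orthogonality of order (exactly) `k`: in addition, the moment of order `n - k`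
does not vanish. -/
structure IsDiscreteQuasiOrthogonal (N : ℕ) (μ w : ℕ → ℝ) (n k : ℕ) (Q : ℝ[X]) : Prop
    extends IsWeakQuasiOrthogonal N μ w n k Q where
  order_le : k ≤ n
  moment_ne_zero : discreteMoment N μ w Q (n - k) ≠ 0

/-- The number of distinct real zeros of `Q` in the open interval `(a, b)`. -/
noncomputable def numZerosIoo (Q : ℝ[X]) (a b : ℝ) : ℕ :=
  Set.ncard {y : ℝ | y ∈ Set.Ioo a b ∧ Q.IsRoot y}

/-- The `q`-Racah data on `{0, …, N}` are admissible: the nodes are distinct, the weight is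
defined and nonzero at each node (a vanishing denominator gives the value `0` here, so it is
excluded), and the denominators `(αβq^{m+1}; q)_m`, `m ≤ N`, do not vanish. -/
structure QRacahAdmissible (q : ℝ) (N : ℕ) (α β γ δ : ℝ) : Prop where
  node_injOn : Set.InjOn (qRacahNode q γ δ) (Set.Iic N)
  weight_ne_zero : ∀ x ≤ N, qRacahWeight q α β γ δ x ≠ 0
  param_ne : ∀ j : ℕ, 2 ≤ j → j ≤ 2 * N → α * β * q ^ j ≠ 1

/-- The weight is positive at every node, and `μ(0) < μ(1) < ⋯ < μ(N)`. -/
structure QRacahPositive (q : ℝ) (N : ℕ) (α β γ δ : ℝ) : Prop where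
  weight_pos : ∀ x ≤ N, 0 < qRacahWeight q α β γ δ x
  node_lt : ∀ x < N, qRacahNode q γ δ x < qRacahNode q γ δ (x + 1)

/-! In case (i) put b = αq = q^{-N}, and write φ_m for `qRacahBasis` and ψ_l for `qShiftBasis` with
a = γδq. The defining series expands Q in the φ_m, so testing Q against ψ_l only needs the mixed
moments M(m,l) = ∑ φ_m ψ_l w. At the nodes, φ_m vanishes for x < m and ψ_l for x > N - l. Hence
M(m,l) = 0 for m + l > N and is a single term for m + l = N; a recurrence, valid for any weight,
then determines all the others. This makes M an explicit product
(`QRacahAdmissible.exists_mixedMoment_eq`).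

Inserting that product cancels (βδq, γq; q)_m from the series and leaves a balanced ₃φ₂. By
`qSaalschutz`, the moment of Q against ψ_l is a nonzero multiple of ∏_{j<n} (bq^l - bq^{j-k})(1 -
βq^{j+1}). For l < n - k the factor j = l + k vanishes. For l = n - k no first factor vanishes, and
among the second ones only 1 - βq^n is not controlled by admissibility. As ψ_l is monic of degree l,
this proves (a).

For (b), multiply Q by the linear factors at its sign changes: too few of them would contradict
orthogonality with positive weights. Case (ii) is case (i) for the parameters (βδ, α/δ), which leave
weight and polynomial unchanged. -/

/-! ### q-shifted factorials -/

theorem qPoch_zero (a q : ℝ) : qPoch a q 0 = 1 := by simp [qPoch]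

theorem qPoch_succ (a q : ℝ) (m : ℕ) : qPoch a q (m + 1) = qPoch a q m * (1 - a * q ^ m) := by
  simp [qPoch, Finset.prod_range_succ]

theorem qPoch_succ' (a q : ℝ) (m : ℕ) : qPoch a q (m + 1) = (1 - a) * qPoch (a * q) q m := by
  simp only [qPoch, Finset.prod_range_succ']
  rw [mul_comm]
  congr 1
  · simp
  · exact Finset.prod_congr rfl fun j _ => by ring

theorem qPoch_add (a q : ℝ) (m l : ℕ) :
    qPoch a q (l + m) = qPoch a q l * qPoch (a * q ^ l) q m := by
  simp only [qPoch, Finset.prod_range_add]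
  congr 1
  exact Finset.prod_congr rfl fun j _ => by ring

theorem qPoch_ne_zero_iff (a q : ℝ) (m : ℕ) :
    qPoch a q m ≠ 0 ↔ ∀ j < m, a * q ^ j ≠ 1 := by
  simp only [qPoch, Finset.prod_ne_zero_iff, Finset.mem_range]
  exact forall₂_congr fun j _ => by rw [sub_ne_zero, ne_comm]

theorem qPoch_eq_zero {a q : ℝ} {m j : ℕ} (hj : j < m) (h : a * q ^ j = 1) : qPoch a q m = 0 :=
  Finset.prod_eq_zero (Finset.mem_range.2 hj) (by rw [h, sub_self])

/-! ### The q-Saalschütz summation -/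

/-- The telescoped form of one step in `n` of the `q`-Saalschütz sum. -/
theorem qSaalschutz_telescope {q A C D E : ℝ} (hq : q ≠ 0) (hA : A ≠ 0) (hCD : C * D = q * E * A)
    (n M : ℕ) (hC : ∀ j < M, C * q ^ j ≠ 1) (hD : ∀ j < M, D * q ^ j ≠ 1)
    (hqj : ∀ j < M, q * q ^ j ≠ 1) :
    ∑ m ∈ Finset.range (M + 1),
      ((1 - C * q ^ n) * (1 - D * q ^ n) *
          (qPoch ((q ^ (n + 1))⁻¹) q m * qPoch (E * q ^ (n + 1)) q m * qPoch A q m * q ^ m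
            / (qPoch C q m * qPoch D q m * qPoch q q m))
        - (A - C * q ^ n) * (1 - D * q ^ n / A) *
          (qPoch ((q ^ n)⁻¹) q m * qPoch (E * q ^ n) q m * qPoch A q m * q ^ m
            / (qPoch C q m * qPoch D q m * qPoch q q m)))
      = (1 - E * q ^ (2 * n + 1)) * (qPoch ((q ^ n)⁻¹) q M * qPoch (E * q ^ (n + 1)) q M *
          qPoch A q (M + 1) / (qPoch C q M * qPoch D q M * qPoch q q M)) := by
  induction M with
  | zero =>
    simp only [zero_add, Finset.sum_range_one, qPoch_zero, qPoch_succ]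
    field_simp
    linear_combination (q ^ n * q ^ n) * (A - 1) * hCD
  | succ M ih =>
    rw [Finset.sum_range_succ, ih (fun j hj => hC j (by lia)) (fun j hj => hD j (by lia))
      (fun j hj => hqj j (by lia))]
    have h1 := (qPoch_ne_zero_iff C q M).2 fun j hj => hC j (by lia)
    have h2 := (qPoch_ne_zero_iff D q M).2 fun j hj => hD j (by lia)
    have h3 := (qPoch_ne_zero_iff q q M).2 fun j hj => hqj j (by lia)
    have h4 := sub_ne_zero.2 (hC M (by lia)).symm
    have h5 := sub_ne_zero.2 (hD M (by lia)).symm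
    have h6 := sub_ne_zero.2 (hqj M (by lia)).symm
    have hqn : q ^ n ≠ 0 := pow_ne_zero _ hq
    have e1 : qPoch ((q ^ (n + 1))⁻¹) q (M + 1)
        = (1 - (q ^ (n + 1))⁻¹) * qPoch ((q ^ n)⁻¹) q M := by
      rw [qPoch_succ', pow_succ, mul_inv, inv_mul_cancel_right₀ hq]
    have e2 : qPoch (E * q ^ n) q (M + 1) = (1 - E * q ^ n) * qPoch (E * q ^ (n + 1)) q M := by
      rw [qPoch_succ', pow_succ, mul_assoc]
    rw [e1, e2]
    simp only [qPoch_succ _ _ (M + 1), qPoch_succ _ _ M]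
    generalize qPoch C q M = c at *
    generalize qPoch D q M = d at *
    generalize qPoch q q M = e at *
    generalize qPoch A q M = f at *
    generalize qPoch ((q ^ n)⁻¹) q M = g at *
    generalize qPoch (E * q ^ (n + 1)) q M = h at *
    have hE : E = C * D / (q * A) := by field_simp; linear_combination -hCD
    subst hE
    rw [show q ^ (2 * n + 1) = q ^ n * q ^ n * q by ring, pow_succ q n, pow_succ q M]
    generalize q ^ n = x at *
    generalize q ^ M = y at *
    field_simp
    ring

/-- The `q`-Saalschütz sum for a terminating balanced `₃φ₂`. -/
theorem qSaalschutz {q A C D E : ℝ} (hq : q ≠ 0) (hA : A ≠ 0) (hCD : C * D = q * E * A)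
    (n : ℕ) (hC : ∀ j < n, C * q ^ j ≠ 1) (hD : ∀ j < n, D * q ^ j ≠ 1)
    (hqj : ∀ j < n, q * q ^ j ≠ 1) :
    ∑ m ∈ Finset.range (n + 1),
      qPoch ((q ^ n)⁻¹) q m * qPoch (E * q ^ n) q m * qPoch A q m * q ^ m
            / (qPoch C q m * qPoch D q m * qPoch q q m)
      = ∏ j ∈ Finset.range n, (A - C * q ^ j) * (1 - D * q ^ j / A)
          / ((1 - C * q ^ j) * (1 - D * q ^ j)) := by
  induction n with
  | zero => simp [qPoch_zero]
  | succ n ih =>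
    have key := qSaalschutz_telescope hq hA hCD n (n + 1) hC hD hqj
    -- This factor kills the telescoped boundary term at M = n + 1, and also the extra top term of
    -- the level-n sum.
    have hz : qPoch ((q ^ n)⁻¹) q (n + 1) = 0 :=
      qPoch_eq_zero n.lt_succ_self (inv_mul_cancel₀ (pow_ne_zero n hq))
    rw [hz, Finset.sum_sub_distrib, ← Finset.mul_sum, ← Finset.mul_sum,
      Finset.sum_range_succ _ (n + 1), Finset.sum_range_succ _ (n + 1), hz] at key
    rw [Finset.sum_range_succ _ (n + 1), Finset.prod_range_succ, ← ih (fun j hj => hC j (by lia))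
      (fun j hj => hD j (by lia)) (fun j hj => hqj j (by lia))]
    have h4 := sub_ne_zero.2 (hC n (by lia)).symm
    have h5 := sub_ne_zero.2 (hD n (by lia)).symm
    simp only [zero_mul, mul_zero, zero_div, add_zero] at key
    rw [mul_div_assoc', eq_div_iff (mul_ne_zero h4 h5)]
    linear_combination key

/-! ### The two bases and their values at the nodes -/

/-- The monic basis polynomial `∏_{j < l} (y - b q^j - a / (b q^j))` in the lattice variable. -/
noncomputable def qShiftBasis (q a b : ℝ) (l : ℕ) : ℝ[X] :=
  ∏ j ∈ Finset.range l, (X - C (b * q ^ j + a / (b * q ^ j)))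

theorem qShiftBasis_succ (q a b : ℝ) (l : ℕ) :
    qShiftBasis q a b (l + 1) = qShiftBasis q a b l * (X - C (b * q ^ l + a / (b * q ^ l))) := by
  simp [qShiftBasis, Finset.prod_range_succ]

theorem qShiftBasis_monic (q a b : ℝ) (l : ℕ) : (qShiftBasis q a b l).Monic :=
  monic_prod_of_monic _ _ fun _ _ => monic_X_sub_C _

theorem qShiftBasis_natDegree (q a b : ℝ) (l : ℕ) : (qShiftBasis q a b l).natDegree = l := by
  rw [qShiftBasis, natDegree_prod_of_monic _ _ fun _ _ => monic_X_sub_C _]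
  simp only [natDegree_X_sub_C, Finset.sum_const, Finset.card_range, smul_eq_mul, mul_one]

theorem qRacahBasis_succ (q γ δ : ℝ) (m : ℕ) :
    qRacahBasis q γ δ (m + 1)
      = qRacahBasis q γ δ m * (C (1 + γ * δ * q ^ (2 * m + 1)) - C (q ^ m) * X) := by
  simp [qRacahBasis, Finset.prod_range_succ]

theorem qRacahNode_eq {q : ℝ} (hq : q ≠ 0) (γ δ : ℝ) (x : ℕ) :
    qRacahNode q γ δ x = (q ^ x)⁻¹ + γ * δ * q / (q ^ x)⁻¹ := by
  have := pow_ne_zero x hq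
  rw [qRacahNode, pow_succ]
  field_simp

theorem qRacahBasis_eval_node {q : ℝ} (hq : q ≠ 0) (γ δ : ℝ) (m x : ℕ) :
    (qRacahBasis q γ δ m).eval (qRacahNode q γ δ x)
      = qPoch ((q ^ x)⁻¹) q m * qPoch (γ * δ * q * q ^ x) q m := by
  rw [qRacahNode_eq hq, qRacahBasis_eval _ _ _ _ (inv_ne_zero (pow_ne_zero x hq)), div_inv_eq_mul]

theorem qRacahBasis_eval_node_eq_zero {q : ℝ} (hq : q ≠ 0) (γ δ : ℝ) {m x : ℕ} (h : x < m) :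
    (qRacahBasis q γ δ m).eval (qRacahNode q γ δ x) = 0 := by
  rw [qRacahBasis_eval_node hq, qPoch_eq_zero h (inv_mul_cancel₀ (pow_ne_zero x hq)), zero_mul]

theorem qShiftBasis_factor {q b : ℝ} (hq : q ≠ 0) (hb : b ≠ 0) (γ δ : ℝ) (j x : ℕ) :
    qRacahNode q γ δ x - (b * q ^ j + γ * δ * q / (b * q ^ j))
      = (q ^ x)⁻¹ * (1 - b * q ^ (x + j)) * (1 - γ * δ * q * q ^ x / (b * q ^ j)) := by
  have := pow_ne_zero x hq
  have := pow_ne_zero j hq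
  unfold qRacahNode
  rw [pow_add, pow_succ]
  field_simp
  ring

theorem qShiftBasis_eval_node_succ {q b : ℝ} (hq : q ≠ 0) (hb : b ≠ 0) (γ δ : ℝ) (l x : ℕ) :
    (qShiftBasis q (γ * δ * q) b (l + 1)).eval (qRacahNode q γ δ x)
      = (qShiftBasis q (γ * δ * q) b l).eval (qRacahNode q γ δ x) *
        ((q ^ x)⁻¹ * (1 - b * q ^ (x + l)) * (1 - γ * δ * q * q ^ x / (b * q ^ l))) := by
  rw [qShiftBasis_succ, eval_mul, eval_sub, eval_X, eval_C, qShiftBasis_factor hq hb]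

theorem qShiftBasis_eval_node_eq_zero {q b : ℝ} (hq : q ≠ 0) (hb : b ≠ 0) (γ δ : ℝ) {l x N : ℕ}
    (hbN : b * q ^ N = 1) (hx : x ≤ N) (h : N < x + l) :
    (qShiftBasis q (γ * δ * q) b l).eval (qRacahNode q γ δ x) = 0 := by
  rw [qShiftBasis, eval_prod]
  -- The factor j = N - x contains 1 - b q^{x+j} = 1 - b q^N = 0.
  refine Finset.prod_eq_zero (i := N - x) (Finset.mem_range.2 (by lia)) ?_
  rw [eval_sub, eval_X, eval_C, qShiftBasis_factor hq hb, Nat.add_sub_cancel' hx, hbN]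
  simp

/-- Raising the node by one shifts the factor index by one, so the two products agree up to boundary
factors. The relation is cross-multiplied to avoid a division. -/
theorem qShiftBasis_eval_node_shift {q b : ℝ} (hq : q ≠ 0) (hb : b ≠ 0) (γ δ : ℝ) (l m : ℕ) :
    (qShiftBasis q (γ * δ * q) b (l + 1)).eval (qRacahNode q γ δ m)
        * (1 - γ * δ * q * q ^ (m + 1) / b)
      = (qShiftBasis q (γ * δ * q) b l).eval (qRacahNode q γ δ (m + 1)) *
        (q ^ l * (q ^ m)⁻¹ * (1 - b * q ^ m) * (1 - γ * δ * q * q ^ m / (b * q ^ l))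
          * (1 - γ * δ * q * q ^ (m + 1) / (b * q ^ l))) := by
  have hm := pow_ne_zero m hq
  induction l with
  | zero =>
    rw [qShiftBasis_eval_node_succ hq hb]
    simp [qShiftBasis]
  | succ l ih =>
    have hl := pow_ne_zero l hq
    rw [qShiftBasis_eval_node_succ hq hb, qShiftBasis_eval_node_succ hq hb _ _ l (m + 1),
      mul_right_comm, ih]
    generalize (qShiftBasis q (γ * δ * q) b l).eval (qRacahNode q γ δ (m + 1)) = f
    rw [show q ^ (m + (l + 1)) = q ^ m * q ^ l * q by ring,
      show q ^ (m + 1 + l) = q ^ m * q ^ l * q by ring, pow_succ q m, pow_succ q l]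
    generalize q ^ m = x at *
    generalize q ^ l = y at *
    field_simp

theorem qRacahBasis_eval_diag_succ {q : ℝ} (hq : q ≠ 0) (γ δ : ℝ) (m : ℕ) :
    (qRacahBasis q γ δ (m + 1)).eval (qRacahNode q γ δ (m + 1)) * (1 - γ * δ * q * q ^ m)
      = (qRacahBasis q γ δ m).eval (qRacahNode q γ δ m) * ((1 - (q ^ (m + 1))⁻¹) *
        (1 - γ * δ * q * q ^ (2 * m)) * (1 - γ * δ * q * q ^ (2 * m + 1))) := by
  rw [qRacahBasis_eval_node hq, qRacahBasis_eval_node hq, qPoch_succ' ((q ^ (m + 1))⁻¹)]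
  have e1 : (q ^ (m + 1))⁻¹ * q = (q ^ m)⁻¹ := by
    rw [pow_succ, mul_inv, inv_mul_cancel_right₀ hq]
  have e2 : qPoch (γ * δ * q * q ^ (m + 1)) q (m + 1) * (1 - γ * δ * q * q ^ m)
      = qPoch (γ * δ * q * q ^ m) q m * (1 - γ * δ * q * q ^ (2 * m)) *
        (1 - γ * δ * q * q ^ (2 * m + 1)) := by
    have h1 := qPoch_succ' (γ * δ * q * q ^ m) q (m + 1)
    rw [qPoch_succ, qPoch_succ] at h1
    rw [show γ * δ * q * q ^ (m + 1) = γ * δ * q * q ^ m * q by ring]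
    rw [mul_comm, ← h1]
    ring
  rw [e1]
  linear_combination (1 - (q ^ (m + 1))⁻¹) * qPoch ((q ^ m)⁻¹) q m * e2

/-! ### Mixed moments for an arbitrary weight -/

/-- The sum of `w` against the product of the two bases over the nodes. -/
noncomputable def qMixedMoment (N : ℕ) (q γ δ b : ℝ) (w : ℕ → ℝ) (m l : ℕ) : ℝ :=
  ∑ x ∈ Finset.range (N + 1),
    (qRacahBasis q γ δ m * qShiftBasis q (γ * δ * q) b l).eval (qRacahNode q γ δ x) * w x

/-- The next factor of φ_m plus q^m times the next factor of ψ_l no longer involves y; the resulting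
constant factors as on the right. -/
theorem qMixedMoment_recurrence (N : ℕ) {q b : ℝ} (hq : q ≠ 0) (hb : b ≠ 0) (γ δ : ℝ)
    (w : ℕ → ℝ) (m l : ℕ) :
    qMixedMoment N q γ δ b w (m + 1) l + q ^ m * qMixedMoment N q γ δ b w m (l + 1)
      = (1 - b * q ^ (m + l)) * (1 - γ * δ * q * q ^ m / (b * q ^ l))
        * qMixedMoment N q γ δ b w m l := by
  have hl := pow_ne_zero l hq
  simp only [qMixedMoment, Finset.mul_sum, ← Finset.sum_add_distrib]
  refine Finset.sum_congr rfl fun x _ => ?_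
  simp only [qRacahBasis_succ, qShiftBasis_succ, eval_mul, eval_sub, eval_X, eval_C]
  rw [pow_add q m l]
  field_simp
  ring

theorem qMixedMoment_eq_zero {N : ℕ} {q b : ℝ} (hq : q ≠ 0) (hb : b ≠ 0) (γ δ : ℝ)
    (hbN : b * q ^ N = 1) (w : ℕ → ℝ) {m l : ℕ} (h : N < m + l) :
    qMixedMoment N q γ δ b w m l = 0 := by
  refine Finset.sum_eq_zero fun x hx => ?_
  rw [Finset.mem_range] at hx
  rw [eval_mul]
  rcases lt_or_ge x m with h1 | h1
  · rw [qRacahBasis_eval_node_eq_zero hq _ _ h1]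
    ring
  · rw [qShiftBasis_eval_node_eq_zero hq hb γ δ hbN (by lia) (by lia)]
    ring

theorem qMixedMoment_diag {N : ℕ} {q b : ℝ} (hq : q ≠ 0) (hb : b ≠ 0) (γ δ : ℝ)
    (hbN : b * q ^ N = 1) (w : ℕ → ℝ) {m l : ℕ} (h : m + l = N) :
    qMixedMoment N q γ δ b w m l = (qRacahBasis q γ δ m).eval (qRacahNode q γ δ m)
      * (qShiftBasis q (γ * δ * q) b l).eval (qRacahNode q γ δ m) * w m := by
  rw [qMixedMoment, Finset.sum_eq_single_of_mem m (Finset.mem_range.2 (by lia)), eval_mul]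
  intro x hx hxm
  rw [Finset.mem_range] at hx
  rw [eval_mul]
  rcases lt_or_gt_of_ne hxm with h1 | h1
  · rw [qRacahBasis_eval_node_eq_zero hq _ _ h1]
    ring
  · rw [qShiftBasis_eval_node_eq_zero hq hb γ δ hbN (by lia) (by lia)]
    ring

/-! ### Node differences and ratios of consecutive weights -/

theorem qRacahNode_sub {q : ℝ} (hq : q ≠ 0) (γ δ : ℝ) (x y : ℕ) :
    qRacahNode q γ δ x - qRacahNode q γ δ y
      = ((q ^ x)⁻¹ - (q ^ y)⁻¹) * (1 - γ * δ * q * q ^ (x + y)) := by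
  have := pow_ne_zero x hq
  have := pow_ne_zero y hq
  unfold qRacahNode
  rw [pow_add, pow_succ, pow_succ]
  field_simp
  ring

theorem qRacahWeight_succ {q α β γ δ : ℝ} {x : ℕ}
    (h : qRacahWeight q α β γ δ (x + 1) ≠ 0) (h0 : qRacahWeight q α β γ δ x ≠ 0) :
    qRacahWeight q α β γ δ (x + 1) *
      ((1 - q * q ^ x) * (1 - γ * δ * q / α * q ^ x) * (1 - γ * q / β * q ^ x)
        * (1 - δ * q * q ^ x) * (α * β * q) * (1 - γ * δ * q ^ (2 * x + 1)))
      = qRacahWeight q α β γ δ x *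
        ((1 - α * q * q ^ x) * (1 - β * δ * q * q ^ x) * (1 - γ * q * q ^ x)
          * (1 - γ * δ * q * q ^ x) * (1 - γ * δ * q ^ (2 * (x + 1) + 1))) := by
  unfold qRacahWeight at *
  have hd := (div_ne_zero_iff.1 h).2
  have hd0 := (div_ne_zero_iff.1 h0).2
  generalize γ * δ * q / α = u at *
  generalize γ * q / β = v at *
  rw [div_mul_eq_mul_div, div_mul_eq_mul_div, div_eq_div_iff hd hd0]
  simp only [qPoch_succ, pow_succ (α * β * q)]
  ring

/-! ### Sign changes and zeros -/

/-- A nonzero polynomial acquires a constant sign on `[a, b]` after multiplication by the linear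
factors of some of its roots in `(a, b)`. -/
theorem exists_finset_roots_mul_prod_sign {a b : ℝ} (hab : a < b) (n : ℕ) :
    ∀ Q : ℝ[X], Q ≠ 0 → Q.natDegree = n →
      ∃ (Z : Finset ℝ) (s : ℝ), s ≠ 0 ∧ (∀ z ∈ Z, z ∈ Set.Ioo a b ∧ Q.IsRoot z) ∧
        ∀ y ∈ Set.Icc a b, 0 ≤ s * (Q * ∏ z ∈ Z, (X - C z)).eval y := by
  induction n with
  | zero =>
    intro Q hQ hn
    obtain ⟨c, rfl⟩ := natDegree_eq_zero.1 hn
    exact ⟨∅, c, by simpa using hQ, by simp, fun y _ => by simpa using mul_self_nonneg c⟩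
  | succ n ih =>
    intro Q hQ hn
    by_cases h : ∃ z ∈ Set.Ioo a b, Q.IsRoot z
    · obtain ⟨z, hz, hroot⟩ := h
      obtain ⟨R, rfl⟩ := dvd_iff_isRoot.2 hroot
      have hR : R ≠ 0 := right_ne_zero_of_mul hQ
      rw [natDegree_mul (X_sub_C_ne_zero z) hR, natDegree_X_sub_C] at hn
      obtain ⟨Z, s, hs, hZ, hpos⟩ := ih R hR (by lia)
      have hmul : ∀ y, R.IsRoot y → ((X - C z) * R).IsRoot y := fun y hy => by
        simp only [IsRoot, eval_mul] at hy ⊢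
        rw [hy, mul_zero]
      -- Toggling z in Z keeps the sign: if z ∈ Z, the factor X - z of Q replaces the one removed
      -- from the product; otherwise inserting z creates the square (X - z)².
      by_cases hzZ : z ∈ Z
      · refine ⟨Z.erase z, s, hs, fun y hy => ?_, fun y hy => ?_⟩
        · have := hZ y (Finset.mem_of_mem_erase hy)
          exact ⟨this.1, hmul y this.2⟩
        · have := hpos y hy
          rwa [← Finset.mul_prod_erase Z _ hzZ, ← mul_assoc, mul_comm R] at this
      · refine ⟨insert z Z, s, hs, fun y hy => ?_, fun y hy => ?_⟩
        · rcases Finset.mem_insert.1 hy with rfl | hy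
          · exact ⟨hz, hroot⟩
          · exact ⟨(hZ y hy).1, hmul y (hZ y hy).2⟩
        · rw [Finset.prod_insert hzZ]
          have := mul_nonneg (sq_nonneg (y - z)) (hpos y hy)
          simp only [eval_mul, eval_sub, eval_X, eval_C] at this ⊢
          linear_combination this
    -- Without roots in (a, b) the sign is constant there by the intermediate value theorem, and it
    -- extends to [a, b] by closure.
    · push Not at h
      obtain ⟨c, hc⟩ : ∃ c, c ∈ Set.Ioo a b := Set.nonempty_Ioo.2 hab
      have hpos : ∀ y ∈ Set.Ioo a b, 0 < Q.eval c * Q.eval y := by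
        intro y hy
        by_contra hneg
        have hzero : (0 : ℝ) ∈ Set.uIcc (Q.eval c) (Q.eval y) := by
          rw [Set.mem_uIcc]
          rcases le_total 0 (Q.eval c) with h1 | h1 <;> rcases le_total 0 (Q.eval y) with h2 | h2
          · have := mul_nonneg h1 h2
            have h0 : Q.eval c * Q.eval y = 0 := by linarith
            rcases mul_eq_zero.1 h0 with h0 | h0
            · exact absurd h0 (h c hc)
            · exact absurd h0 (h y hy)
          · exact Or.inr ⟨h2, h1⟩
          · exact Or.inl ⟨h1, h2⟩
          · have := mul_nonneg_of_nonpos_of_nonpos h1 h2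
            have h0 : Q.eval c * Q.eval y = 0 := by linarith
            rcases mul_eq_zero.1 h0 with h0 | h0
            · exact absurd h0 (h c hc)
            · exact absurd h0 (h y hy)
        obtain ⟨t, ht, ht0⟩ := intermediate_value_uIcc (f := fun y => Q.eval y)
          Q.continuous.continuousOn hzero
        exact h t ((Set.ordConnected_Ioo.uIcc_subset hc hy) ht) ht0
      refine ⟨∅, Q.eval c, h c hc, by simp, fun y hy => ?_⟩
      have hcl : IsClosed {y : ℝ | 0 ≤ Q.eval c * Q.eval y} :=
        isClosed_le continuous_const (continuous_const.mul Q.continuous)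
      have hsub : closure (Set.Ioo a b) ⊆ {y : ℝ | 0 ≤ Q.eval c * Q.eval y} :=
        hcl.closure_subset_iff.2 fun y hy => (hpos y hy).le
      rw [closure_Ioo hab.ne] at hsub
      simpa using hsub hy

/-- If `∑ P(μ x) Q(μ x) w x = 0` for all `P` of degree less than `d`, with positive weights at more
than `deg Q` increasing nodes, then `Q` has at least `d` zeros between the extreme nodes. -/
theorem le_numZerosIoo_of_orthogonal {N d : ℕ} {μ w : ℕ → ℝ} {Q : ℝ[X]} (hN : 0 < N) (hQ0 : Q ≠ 0)
    (hQ : Q.natDegree ≤ N) (hμ : ∀ x < N, μ x < μ (x + 1)) (hw : ∀ x ≤ N, 0 < w x)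
    (horth : ∀ P : ℝ[X], P.degree < d →
      ∑ x ∈ Finset.range (N + 1), (P * Q).eval (μ x) * w x = 0) :
    d ≤ numZerosIoo Q (μ 0) (μ N) := by
  have hmono : StrictMonoOn μ (Set.Iic N) := by
    refine strictMonoOn_of_lt_add_one Set.ordConnected_Iic fun x _ _ hx => ?_
    exact hμ x (by simpa using hx)
  have hab : μ 0 < μ N := hmono (by simp) (by simp) hN
  obtain ⟨Z, s, hs, hZ, hpos⟩ := exists_finset_roots_mul_prod_sign hab _ Q hQ0 rfl
  have hfin : {y : ℝ | y ∈ Set.Ioo (μ 0) (μ N) ∧ Q.IsRoot y}.Finite :=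
    (finite_setOfPred_isRoot hQ0).subset fun y hy => hy.2
  have hcard : Z.card ≤ numZerosIoo Q (μ 0) (μ N) := by
    rw [numZerosIoo, ← Set.ncard_coe_finset]
    exact Set.ncard_le_ncard (fun z hz => hZ z hz) hfin
  refine le_trans ?_ hcard
  by_contra! hlt
  have hdeg : degree (∏ z ∈ Z, (X - C z)) < (d : WithBot ℕ) := by
    rw [degree_prod]
    simpa using hlt
  have hsum := horth _ hdeg
  -- A vanishing sum of nonnegative terms has only zero terms. A node where the extra product
  -- vanishes lies in Z, so it is a root of Q as well; thus Q has N + 1 roots.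
  have hroots : ∀ x ∈ Finset.range (N + 1), Q.IsRoot (μ x) := by
    have hmem : ∀ x ∈ Finset.range (N + 1), x ≤ N := fun x hx => by
      simpa [Nat.lt_succ_iff] using hx
    have hsum' : ∑ x ∈ Finset.range (N + 1),
        s * (Q * ∏ z ∈ Z, (X - C z)).eval (μ x) * w x = 0 := by
      simp only [mul_comm Q, mul_assoc s, ← Finset.mul_sum, hsum, mul_zero]
    rw [Finset.sum_eq_zero_iff_of_nonneg] at hsum'
    · intro x hx
      have h0 := hsum' x hx
      simp only [mul_eq_zero, hs, (hw x (hmem x hx)).ne', eval_mul, false_or, or_false] at h0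
      rcases h0 with h0 | h0
      · exact h0
      · rw [eval_prod, Finset.prod_eq_zero_iff] at h0
        obtain ⟨z, hz, hz0⟩ := h0
        have : μ x = z := by simpa [sub_eq_zero] using hz0
        exact this ▸ (hZ z hz).2
    · intro x hx
      refine mul_nonneg (hpos _ ⟨?_, ?_⟩) (hw x (hmem x hx)).le
      · exact hmono.monotoneOn (by simp) (hmem x hx) (Nat.zero_le x)
      · exact hmono.monotoneOn (hmem x hx) (by simp) (hmem x hx)
  have hle : ((Finset.range (N + 1)).image μ).card ≤ Q.natDegree := by
    refine card_le_degree_of_subset_roots fun y hy => ?_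
    obtain ⟨x, hx, rfl⟩ := Finset.mem_image.1 (Finset.mem_def.2 hy)
    exact (mem_roots hQ0).2 (hroots x hx)
  rw [Finset.card_image_of_injOn, Finset.card_range] at hle
  · lia
  · exact hmono.injOn.mono fun x hx => by simpa [Nat.lt_succ_iff] using hx

/-! ### Evaluation of the mixed moments for the q-Racah weight -/

/-- The closed form of `qMixedMoment` for the `q`-Racah weight, up to the total mass `K`. -/
noncomputable def qMixedClosedForm (K q β γ δ b : ℝ) (m l : ℕ) : ℝ :=
  K * qPoch b q (m + l) * qPoch (β * δ * q) q m * qPoch (γ * q) q m *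
    (∏ j ∈ Finset.range l, (-(q / (b * q ^ j)) * (γ - β * (b * q ^ j)) * (δ - b * q ^ j))) /
      qPoch (β * b * q) q (m + l)

theorem qMixedClosedForm_recurrence {K q β γ δ b : ℝ} (hq : q ≠ 0) (hb : b ≠ 0) {m l : ℕ}
    (h : β * b * q * q ^ (m + l) ≠ 1) :
    qMixedClosedForm K q β γ δ b (m + 1) l + q ^ m * qMixedClosedForm K q β γ δ b m (l + 1)
      = (1 - b * q ^ (m + l)) * (1 - γ * δ * q * q ^ m / (b * q ^ l))
        * qMixedClosedForm K q β γ δ b m l := by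
  have hm := pow_ne_zero m hq
  have hl := pow_ne_zero l hq
  have h' := sub_ne_zero.2 h.symm
  unfold qMixedClosedForm
  rw [show m + 1 + l = m + l + 1 by ring, ← add_assoc]
  simp only [qPoch_succ, Finset.prod_range_succ]
  generalize qPoch (β * b * q) q (m + l) = d
  generalize qPoch b q (m + l) = e
  generalize qPoch (β * δ * q) q m = f
  generalize qPoch (γ * q) q m = g
  generalize ∏ j ∈ Finset.range l,
    (-(q / (b * q ^ j)) * (γ - β * (b * q ^ j)) * (δ - b * q ^ j)) = p
  rw [pow_add] at h' ⊢
  generalize q ^ m = x at *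
  generalize q ^ l = y at *
  -- If d = 0, all three closed forms are 0 by the convention for division by zero.
  rcases eq_or_ne d 0 with rfl | hd
  · simp
  -- The new denominator factor becomes a free variable r, and β is eliminated in its favour.
  obtain ⟨r, hr⟩ : ∃ r, r = 1 - β * b * q * (x * y) := ⟨_, rfl⟩
  have hβ : β = (1 - r) / (b * q * (x * y)) := by
    rw [hr]
    field_simp
    ring
  rw [← hr] at h' ⊢
  subst hβ
  field_simp
  ring

/-- Moving along an antidiagonal leaves the factors depending on m + l unchanged, so only one factor
of each remaining product is exchanged. -/
theorem qMixedClosedForm_step {K q β γ δ b : ℝ} {m l : ℕ} :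
    qMixedClosedForm K q β γ δ b (m + 1) l
        * (-(q / (b * q ^ l)) * (γ - β * (b * q ^ l)) * (δ - b * q ^ l))
      = qMixedClosedForm K q β γ δ b m (l + 1)
        * ((1 - β * δ * q * q ^ m) * (1 - γ * q * q ^ m)) := by
  unfold qMixedClosedForm
  rw [show m + 1 + l = m + (l + 1) by ring]
  simp only [qPoch_succ _ _ m, Finset.prod_range_succ]
  ring

/-- For s = 2x this is a numerator factor of w(x); for s = 2x + 1 it divides μ(x) - μ(x+1). -/
theorem QRacahAdmissible.one_sub_ne_zero {q : ℝ} (hq0 : 0 < q) {N : ℕ}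
    {α β γ δ : ℝ} (h : QRacahAdmissible q N α β γ δ) {s : ℕ} (hs : s ≤ 2 * N) :
    1 - γ * δ * q * q ^ s ≠ 0 := by
  rcases Nat.even_or_odd' s with ⟨x, rfl | rfl⟩
  · have := (div_ne_zero_iff.1 (h.weight_ne_zero x (by lia))).1
    convert right_ne_zero_of_mul this using 2
    ring
  · intro h0
    have := qRacahNode_sub hq0.ne' γ δ x (x + 1)
    rw [show x + (x + 1) = 2 * x + 1 by ring, h0, mul_zero, sub_eq_zero] at this
    have := h.node_injOn (Set.mem_Iic.2 (by lia)) (Set.mem_Iic.2 (by lia)) this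
    lia

/-- Since b q^j = q^{-(N-j)}, a zero of the second or third factor would annihilate (γq/β; q)_N or
(δq; q)_N in the denominator of w(N). -/
theorem QRacahAdmissible.shift_factor_ne_zero {q : ℝ} (hq0 : 0 < q) {N : ℕ} {α β γ δ b : ℝ}
    (h : QRacahAdmissible q N α β γ δ) (hbN : b * q ^ N = 1) (hβ : β ≠ 0) {j : ℕ} (hj : j < N) :
    -(q / (b * q ^ j)) * (γ - β * (b * q ^ j)) * (δ - b * q ^ j) ≠ 0 := by
  have hw := (div_ne_zero_iff.1 (h.weight_ne_zero N le_rfl)).2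
  simp only [mul_ne_zero_iff, qPoch_ne_zero_iff] at hw
  obtain ⟨⟨⟨⟨⟨_, _⟩, h1⟩, h2⟩, _⟩, _⟩ := hw
  obtain ⟨i, rfl⟩ : ∃ i, N = j + i + 1 := ⟨N - j - 1, by lia⟩
  have hb : b ≠ 0 := left_ne_zero_of_mul_eq_one hbN
  have hc : b * q ^ j * (q * q ^ i) = 1 := by rw [← hbN]; ring
  have hbj : b * q ^ j ≠ 0 := mul_ne_zero hb (pow_ne_zero _ hq0.ne')
  refine mul_ne_zero (mul_ne_zero (neg_ne_zero.2 (div_ne_zero hq0.ne' hbj)) ?_) ?_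
  · intro h0
    refine h1 i (by lia) ?_
    rw [sub_eq_zero.1 h0, div_mul_eq_mul_div, div_eq_one_iff_eq hβ]
    linear_combination β * hc
  · intro h0
    refine h2 i (by lia) ?_
    rw [sub_eq_zero.1 h0]
    linear_combination hc

/-- On m + l = N the moment is one term, so it suffices to match its ratio from one m to the next
with that of the closed form. -/
theorem QRacahAdmissible.mixedMoment_diag {q : ℝ} (hq0 : 0 < q) (hq1 : q < 1) {N : ℕ}
    {α β γ δ b K : ℝ} (h : QRacahAdmissible q N α β γ δ) (hbN : b * q ^ N = 1) (hα : α * q = b)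
    (hβ : β ≠ 0) (hK : qMixedMoment N q γ δ b (qRacahWeight q α β γ δ) 0 N
      = qMixedClosedForm K q β γ δ b 0 N) (m : ℕ) :
    ∀ l, m + l = N → qMixedMoment N q γ δ b (qRacahWeight q α β γ δ) m l
      = qMixedClosedForm K q β γ δ b m l := by
  have hb : b ≠ 0 := left_ne_zero_of_mul_eq_one hbN
  have hq := hq0.ne'
  induction m with
  | zero =>
    intro l hl
    rw [zero_add] at hl
    rwa [hl]
  | succ m ih =>
    intro l hl
    have ih' := ih (l + 1) (by lia)
    rw [qMixedMoment_diag hq hb γ δ hbN _ (by lia)] at ih' ⊢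
    have h1 := qRacahBasis_eval_diag_succ hq γ δ m
    have h2 := qShiftBasis_eval_node_shift hq hb γ δ l m
    have h3 := qRacahWeight_succ (h.weight_ne_zero (m + 1) (by lia))
      (h.weight_ne_zero m (by lia))
    have h4 := qMixedClosedForm_step (K := K) (q := q) (β := β) (γ := γ) (δ := δ) (b := b)
      (m := m) (l := l)
    have n1 := h.one_sub_ne_zero hq0 (s := m) (by lia)
    have n4 := h.shift_factor_ne_zero hq0 hbN hβ (j := l) (by lia)
    have hx := pow_ne_zero m hq
    have hy := pow_ne_zero l hq
    -- As m + 1 + l = N, b can be eliminated in favour of q^m and q^l.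
    have hbxy : b = (q ^ m * q * q ^ l)⁻¹ := by
      refine eq_inv_of_mul_eq_one_left ?_
      rw [← hbN, ← hl]
      ring
    have hα0 : α ≠ 0 := left_ne_zero_of_mul (hα.trans_ne hb)
    have e1 : γ * δ * q * q ^ m / (b * q ^ l) = γ * δ * q * q ^ (2 * m + 1) := by
      rw [hbxy, show q ^ (2 * m + 1) = q ^ m * q ^ m * q by ring]
      field_simp
    have e2 : γ * δ * q * q ^ (m + 1) / (b * q ^ l) = γ * δ * q * q ^ (2 * m + 2) := by
      rw [hbxy, show q ^ (2 * m + 2) = q ^ m * q ^ m * q * q by ring, pow_succ]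
      field_simp
    have e3 : γ * δ * q / α * q ^ m = γ * δ * q * q ^ (m + 1) / b := by
      rw [← hα, pow_succ]
      field_simp
    have e4 : (1 - (q ^ (m + 1))⁻¹)
          * (-(q / (b * q ^ l)) * (γ - β * (b * q ^ l)) * (δ - b * q ^ l))
        = q ^ l * (q ^ m)⁻¹ * (1 - q * q ^ m) * (1 - γ * q / β * q ^ m) * (1 - δ * q * q ^ m)
          * (b * β) := by
      rw [hbxy, pow_succ]
      generalize q ^ m = x at *
      generalize q ^ l = y at *
      field_simp
      ring
    have n2 : q ^ l * (q ^ m)⁻¹ * (1 - b * q ^ m) * (1 - γ * δ * q * q ^ m / (b * q ^ l))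
          * (1 - γ * δ * q * q ^ (m + 1) / (b * q ^ l)) ≠ 0 := by
      rw [e1, e2]
      refine mul_ne_zero (mul_ne_zero (mul_ne_zero (mul_ne_zero hy (inv_ne_zero hx)) ?_)
        (h.one_sub_ne_zero hq0 (by lia))) (h.one_sub_ne_zero hq0 (by lia))
      have : b * q ^ m = (q ^ (l + 1))⁻¹ := by
        rw [hbxy, pow_succ]
        field_simp
      rw [this, sub_ne_zero, ne_comm]
      exact inv_ne_one.2 (pow_lt_one₀ hq0.le hq1 l.succ_ne_zero).ne
    have n3 : (1 - q * q ^ m) * (1 - γ * δ * q / α * q ^ m) * (1 - γ * q / β * q ^ m)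
        * (1 - δ * q * q ^ m) * (α * β * q) * (1 - γ * δ * q ^ (2 * m + 1)) ≠ 0 := by
      have hd := (div_ne_zero_iff.1 (h.weight_ne_zero (m + 1) (by lia))).2
      have e := (div_ne_zero_iff.1 (h.weight_ne_zero m (by lia))).1
      simp only [qPoch_succ, pow_succ, mul_ne_zero_iff] at hd e ⊢
      tauto
    have hs : (1 - (q ^ (m + 1))⁻¹) * (1 - γ * δ * q * q ^ (2 * m))
          * (1 - γ * δ * q * q ^ (2 * m + 1)) * (1 - γ * δ * q * q ^ (m + 1) / b)
          * ((1 - α * q * q ^ m) * (1 - β * δ * q * q ^ m) * (1 - γ * q * q ^ m)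
            * (1 - γ * δ * q * q ^ m) * (1 - γ * δ * q ^ (2 * (m + 1) + 1)))
          * (-(q / (b * q ^ l)) * (γ - β * (b * q ^ l)) * (δ - b * q ^ l))
        = (1 - β * δ * q * q ^ m) * (1 - γ * q * q ^ m) * (1 - γ * δ * q * q ^ m)
          * (q ^ l * (q ^ m)⁻¹ * (1 - b * q ^ m) * (1 - γ * δ * q * q ^ m / (b * q ^ l))
            * (1 - γ * δ * q * q ^ (m + 1) / (b * q ^ l)))
          * ((1 - q * q ^ m) * (1 - γ * δ * q / α * q ^ m) * (1 - γ * q / β * q ^ m)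
            * (1 - δ * q * q ^ m) * (α * β * q) * (1 - γ * δ * q ^ (2 * m + 1))) := by
      rw [e1, e2, e3, hα, mul_right_comm α, hα]
      linear_combination (1 - γ * δ * q * q ^ (2 * m)) * (1 - γ * δ * q * q ^ (2 * m + 1))
        * (1 - γ * δ * q * q ^ (m + 1) / b) * (1 - b * q ^ m) * (1 - β * δ * q * q ^ m)
        * (1 - γ * q * q ^ m) * (1 - γ * δ * q * q ^ m) * (1 - γ * δ * q ^ (2 * (m + 1) + 1)) * e4
    -- The ratio relations `h1`–`h4` are cross-multiplied; after restoring the nonzero common factor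
    -- they combine linearly through `hs`.
    refine mul_left_cancel₀ (mul_ne_zero (mul_ne_zero (mul_ne_zero n1 n2) n3) n4) ?_
    clear ih n1 n2 n3 n4 hK e1 e2 e3 e4
    generalize (qRacahBasis q γ δ (m + 1)).eval (qRacahNode q γ δ (m + 1)) = B' at *
    generalize (qRacahBasis q γ δ m).eval (qRacahNode q γ δ m) = B at *
    generalize (qShiftBasis q (γ * δ * q) b l).eval (qRacahNode q γ δ (m + 1)) = f' at *
    generalize (qShiftBasis q (γ * δ * q) b (l + 1)).eval (qRacahNode q γ δ m) = f at *
    generalize qRacahWeight q α β γ δ (m + 1) = w' at *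
    generalize qRacahWeight q α β γ δ m = w at *
    generalize qMixedClosedForm K q β γ δ b (m + 1) l = P' at *
    generalize qMixedClosedForm K q β γ δ b m (l + 1) = P at *
    generalize -(q / (b * q ^ l)) * (γ - β * (b * q ^ l)) * (δ - b * q ^ l) = e at *
    generalize (1 - q * q ^ m) * (1 - γ * δ * q / α * q ^ m) * (1 - γ * q / β * q ^ m)
        * (1 - δ * q * q ^ m) * (α * β * q) * (1 - γ * δ * q ^ (2 * m + 1)) = D at *
    generalize (1 - α * q * q ^ m) * (1 - β * δ * q * q ^ m) * (1 - γ * q * q ^ m)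
            * (1 - γ * δ * q * q ^ m) * (1 - γ * δ * q ^ (2 * (m + 1) + 1)) = R at *
    generalize q ^ l * (q ^ m)⁻¹ * (1 - b * q ^ m) * (1 - γ * δ * q * q ^ m / (b * q ^ l))
          * (1 - γ * δ * q * q ^ (m + 1) / (b * q ^ l)) = c2 at *
    generalize (1 - (q ^ (m + 1))⁻¹) * (1 - γ * δ * q * q ^ (2 * m))
          * (1 - γ * δ * q * q ^ (2 * m + 1)) = r1 at *
    generalize (1 - γ * δ * q * q ^ (m + 1) / b) = r2 at *
    generalize (1 - β * δ * q * q ^ m) * (1 - γ * q * q ^ m) = r4 at *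
    generalize 1 - γ * δ * q * q ^ m = c1 at *
    linear_combination c2 * D * e * f' * w' * h1 - B * r1 * D * e * w' * h2
      + B * r1 * f * r2 * e * h3 + r1 * r2 * e * R * ih' + P * hs - c1 * c2 * D * h4

theorem QRacahAdmissible.param_ne' {q : ℝ} {N : ℕ} {α β γ δ b : ℝ}
    (h : QRacahAdmissible q N α β γ δ) (hα : α * q = b) {j : ℕ} (hj : j + 2 ≤ 2 * N) :
    β * b * q * q ^ j ≠ 1 := by
  convert h.param_ne (j + 2) (by lia) hj using 1
  rw [← hα]
  ring

theorem mul_pow_ne_one {q b : ℝ} (hq0 : 0 < q) (hq1 : q < 1) {N j : ℕ} (hbN : b * q ^ N = 1)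
    (hj : j < N) : b * q ^ j ≠ 1 := by
  intro h
  have hb : b ≠ 0 := left_ne_zero_of_mul_eq_one hbN
  exact hj.ne (pow_right_injective₀ hq0 hq1.ne (mul_left_cancel₀ hb (h.trans hbN.symm)))

/-- The terminating `₆φ₅` evaluation: the moments of the `q`-Racah weight with `αq = q^{-N}`
against products of the two bases. -/
theorem QRacahAdmissible.exists_mixedMoment_eq {q : ℝ} (hq0 : 0 < q) (hq1 : q < 1) {N : ℕ}
    (hN : 0 < N) {α β γ δ b : ℝ} (h : QRacahAdmissible q N α β γ δ) (hbN : b * q ^ N = 1)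
    (hα : α * q = b) (hβ : β ≠ 0) :
    ∃ K ≠ 0, ∀ m l, qMixedMoment N q γ δ b (qRacahWeight q α β γ δ) m l
      = qMixedClosedForm K q β γ δ b m l := by
  have hb : b ≠ 0 := left_ne_zero_of_mul_eq_one hbN
  have hq := hq0.ne'
  have hone : qMixedClosedForm 1 q β γ δ b 0 N ≠ 0 := by
    unfold qMixedClosedForm
    simp only [qPoch_zero, zero_add, one_mul, mul_one]
    refine div_ne_zero (mul_ne_zero ?_ (Finset.prod_ne_zero_iff.2 fun j hj => ?_)) ?_
    · exact (qPoch_ne_zero_iff _ _ _).2 fun j hj => mul_pow_ne_one hq0 hq1 hbN hj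
    · exact h.shift_factor_ne_zero hq0 hbN hβ (Finset.mem_range.1 hj)
    · exact (qPoch_ne_zero_iff _ _ _).2 fun j hj => h.param_ne' hα (by lia)
  have hmom : qMixedMoment N q γ δ b (qRacahWeight q α β γ δ) 0 N ≠ 0 := by
    rw [qMixedMoment_diag hq hb γ δ hbN _ (zero_add N)]
    refine mul_ne_zero (mul_ne_zero (by simp [qRacahBasis]) ?_) (h.weight_ne_zero 0 N.zero_le)
    rw [qShiftBasis, eval_prod, Finset.prod_ne_zero_iff]
    intro j hj
    rw [Finset.mem_range] at hj
    rw [eval_sub, eval_X, eval_C, qShiftBasis_factor hq hb, zero_add]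
    refine mul_ne_zero (mul_ne_zero (by simp) ?_) ?_
    · exact sub_ne_zero.2 (mul_pow_ne_one hq0 hq1 hbN hj).symm
    · convert h.one_sub_ne_zero hq0 (s := N - j) (by lia) using 2
      have : b * q ^ j * q ^ (N - j) = 1 := by
        rw [mul_assoc, ← pow_add, Nat.add_sub_cancel' hj.le, hbN]
      rw [div_eq_iff (left_ne_zero_of_mul_eq_one this)]
      linear_combination -(γ * δ * q) * this
  -- K is calibrated on the single moment (0, N).
  refine ⟨_, div_ne_zero hmom hone, ?_⟩
  set K := qMixedMoment N q γ δ b (qRacahWeight q α β γ δ) 0 N / qMixedClosedForm 1 q β γ δ b 0 N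
    with hKdef
  have hK : qMixedMoment N q γ δ b (qRacahWeight q α β γ δ) 0 N
      = qMixedClosedForm K q β γ δ b 0 N := by
    have : qMixedClosedForm K q β γ δ b 0 N = K * qMixedClosedForm 1 q β γ δ b 0 N := by
      unfold qMixedClosedForm
      ring
    rw [this, hKdef, div_mul_cancel₀ _ hone]
  -- Descent from the antidiagonal: for m + l < N the coefficient of M(m,l) in the recurrence is
  -- nonzero, so M(m,l) is determined by the two moments above it.
  have hle : ∀ d m l, m + l + d = N → qMixedMoment N q γ δ b (qRacahWeight q α β γ δ) m l
      = qMixedClosedForm K q β γ δ b m l := by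
    intro d
    induction d with
    | zero => exact fun m l hml => h.mixedMoment_diag hq0 hq1 hbN hα hβ hK m l hml
    | succ d ih =>
      intro m l hml
      have h1 := qMixedMoment_recurrence N hq hb γ δ (qRacahWeight q α β γ δ) m l
      rw [ih (m + 1) l (by lia), ih m (l + 1) (by lia),
        qMixedClosedForm_recurrence hq hb (h.param_ne' hα (by lia))] at h1
      refine (mul_left_cancel₀ (mul_ne_zero ?_ ?_) h1).symm
      · exact sub_ne_zero.2 (mul_pow_ne_one hq0 hq1 hbN (by lia)).symm
      · convert h.one_sub_ne_zero hq0 (s := m + (N - l)) (by lia) using 2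
        have : b * q ^ l * q ^ (N - l) = 1 := by
          rw [mul_assoc, ← pow_add, Nat.add_sub_cancel' (by lia), hbN]
        rw [div_eq_iff (left_ne_zero_of_mul_eq_one this), pow_add]
        linear_combination -(γ * δ * q) * q ^ m * this
  intro m l
  rcases le_or_gt (m + l) N with hml | hml
  · exact hle (N - (m + l)) m l (by lia)
  · rw [qMixedMoment_eq_zero hq hb γ δ hbN _ hml, qMixedClosedForm, qPoch_eq_zero hml hbN]
    simp

/-! ### Degree of the q-Racah polynomial -/

theorem natDegree_qRacahBasis {q : ℝ} (hq : q ≠ 0) (γ δ : ℝ) (m : ℕ) :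
    (qRacahBasis q γ δ m).natDegree = m := by
  have hdeg : ∀ j, (C (1 + γ * δ * q ^ (2 * j + 1)) - C (q ^ j) * X : ℝ[X]).natDegree = 1 := by
    intro j
    rw [natDegree_sub_eq_right_of_natDegree_lt]
    · exact natDegree_C_mul_X _ (pow_ne_zero j hq)
    · rw [natDegree_C, natDegree_C_mul_X _ (pow_ne_zero j hq)]
      exact one_pos
  rw [qRacahBasis, natDegree_prod]
  · simp only [hdeg, Finset.sum_const, Finset.card_range, smul_eq_mul, mul_one]
  · intro j _ h0
    have := hdeg j
    rw [h0, natDegree_zero] at this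
    exact zero_ne_one this

theorem natDegree_qRacahPoly {q : ℝ} (hq : q ≠ 0) {n : ℕ} {α β γ δ : ℝ}
    (h1 : qPoch (α * q) q n ≠ 0) (h2 : qPoch (β * δ * q) q n ≠ 0) (h3 : qPoch (γ * q) q n ≠ 0)
    (h4 : qPoch (α * β * q ^ (n + 1)) q n ≠ 0) (h5 : qPoch q q n ≠ 0)
    (h6 : qPoch ((q ^ n)⁻¹) q n ≠ 0) :
    (qRacahPoly q n α β γ δ).natDegree = n := by
  rw [qRacahPoly, natDegree_C_mul
    (div_ne_zero (mul_ne_zero (mul_ne_zero h1 h2) h3) h4), Finset.sum_range_succ]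
  have htop : (C (qPoch ((q ^ n)⁻¹) q n * qPoch (α * β * q ^ (n + 1)) q n
          / (qPoch (α * q) q n * qPoch (β * δ * q) q n * qPoch (γ * q) q n * qPoch q q n)
          * q ^ n) * qRacahBasis q γ δ n).natDegree = n := by
    rw [natDegree_C_mul, natDegree_qRacahBasis hq]
    exact mul_ne_zero (div_ne_zero (mul_ne_zero h6 h4)
      (mul_ne_zero (mul_ne_zero (mul_ne_zero h1 h2) h3) h5)) (pow_ne_zero n hq)
  rcases n.eq_zero_or_pos with rfl | hn
  · simpa using htop
  rw [natDegree_add_eq_right_of_natDegree_lt, htop]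
  rw [htop]
  refine (natDegree_sum_le_of_forall_le (n := n - 1) _ _ fun m hm => ?_).trans_lt (by lia)
  rw [Finset.mem_range] at hm
  refine (natDegree_C_mul_le _ _).trans ?_
  rw [natDegree_qRacahBasis hq]
  lia

/-! ### Moments of the shifted polynomial -/

theorem sum_qRacahPoly_mul_qShiftBasis (N : ℕ) (q : ℝ) (n : ℕ) (α β γ δ b : ℝ) (w : ℕ → ℝ)
    (l : ℕ) :
    ∑ x ∈ Finset.range (N + 1),
        (qShiftBasis q (γ * δ * q) b l * qRacahPoly q n α β γ δ).eval (qRacahNode q γ δ x) * w x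
      = qPoch (α * q) q n * qPoch (β * δ * q) q n * qPoch (γ * q) q n
          / qPoch (α * β * q ^ (n + 1)) q n *
        ∑ m ∈ Finset.range (n + 1),
          qPoch ((q ^ n)⁻¹) q m * qPoch (α * β * q ^ (n + 1)) q m
            / (qPoch (α * q) q m * qPoch (β * δ * q) q m * qPoch (γ * q) q m * qPoch q q m)
            * q ^ m * qMixedMoment N q γ δ b w m l := by
  simp only [qMixedMoment, Finset.mul_sum]
  rw [Finset.sum_comm]
  refine Finset.sum_congr rfl fun x _ => ?_
  simp only [qRacahPoly, eval_mul, eval_C, eval_finsetSum, Finset.mul_sum, Finset.sum_mul]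
  exact Finset.sum_congr rfl fun m _ => by ring

theorem QRacahAdmissible.qPoch_ne_zero {q : ℝ} {N : ℕ} {α β γ δ : ℝ}
    (h : QRacahAdmissible q N α β γ δ) {m : ℕ} (hm : m ≤ N) :
    qPoch (β * δ * q) q m ≠ 0 ∧ qPoch (γ * q) q m ≠ 0 ∧ qPoch q q m ≠ 0 := by
  have hw := div_ne_zero_iff.1 (h.weight_ne_zero m hm)
  simp only [mul_ne_zero_iff] at hw
  tauto

theorem QRacahAdmissible.beta_ne_zero {q : ℝ} {N : ℕ} {α β γ δ : ℝ} (hN : 0 < N)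
    (h : QRacahAdmissible q N α β γ δ) : β ≠ 0 := by
  have hw := (div_ne_zero_iff.1 (h.weight_ne_zero N le_rfl)).2
  rintro rfl
  simp [hN.ne'] at hw

/-- Here b/q^k = q^{-(N+k)}, whose only vanishing factor has index N + k ≥ m. -/
theorem qPoch_shifted_ne_zero {q b : ℝ} (hq0 : 0 < q) (hq1 : q < 1) {N k m : ℕ}
    (hbN : b * q ^ N = 1) (hm : m ≤ N) : qPoch (b / q ^ k) q m ≠ 0 := by
  refine (qPoch_ne_zero_iff _ _ _).2 fun j hj => mul_pow_ne_one (N := N + k) hq0 hq1 ?_ (by lia)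
  have := pow_ne_zero k hq0.ne'
  rw [pow_add, ← hbN]
  field_simp

/-- The powers of q multiplying αβ have exponents n - k + 1 + j, which lie between 2 and 2N because
k < n ≤ N. -/
theorem QRacahAdmissible.qPoch_shifted_ne_zero {q : ℝ} (hq0 : 0 < q) {N n k : ℕ} {α β γ δ : ℝ}
    (h : QRacahAdmissible q N α β γ δ) (hkn : k < n) (hnN : n ≤ N) :
    qPoch (α / q ^ k * β * q ^ (n + 1)) q n ≠ 0 := by
  refine (qPoch_ne_zero_iff _ _ _).2 fun j hj => ?_
  convert h.param_ne (n - k + 1 + j) (by lia) (by lia) using 1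
  have := pow_ne_zero k hq0.ne'
  rw [show n + 1 = (n - k + 1) + k by lia, pow_add q _ k, pow_add q _ j]
  field_simp

theorem QRacahAdmissible.natDegree_shifted {q : ℝ} (hq0 : 0 < q) (hq1 : q < 1) {N n k : ℕ}
    {α β γ δ b : ℝ} (h : QRacahAdmissible q N α β γ δ) (hbN : b * q ^ N = 1) (hα : α * q = b)
    (hkn : k < n) (hnN : n ≤ N) :
    (qRacahPoly q n (α / q ^ k) β γ δ).natDegree = n := by
  obtain ⟨h2, h3, h5⟩ := h.qPoch_ne_zero hnN
  refine natDegree_qRacahPoly hq0.ne' ?_ h2 h3 (h.qPoch_shifted_ne_zero hq0 hkn hnN) h5 ?_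
  · rw [div_mul_eq_mul_div, hα]
    exact _root_.qPoch_shifted_ne_zero hq0 hq1 hbN hnN
  · exact (qPoch_ne_zero_iff _ _ _).2 fun j hj => mul_pow_ne_one hq0 hq1
      (inv_mul_cancel₀ (pow_ne_zero n hq0.ne')) hj

/-- The moments of the shifted `q`-Racah polynomial against `qShiftBasis`, in factored form. -/
theorem QRacahAdmissible.exists_shifted_moment_eq {q : ℝ} (hq0 : 0 < q) (hq1 : q < 1)
    {N n k : ℕ} {α β γ δ b : ℝ} (h : QRacahAdmissible q N α β γ δ) (hbN : b * q ^ N = 1)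
    (hα : α * q = b) (hkn : k < n) (hnN : n ≤ N) {l : ℕ} (hl : l < n) :
    ∃ c ≠ 0, ∑ x ∈ Finset.range (N + 1), (qShiftBasis q (γ * δ * q) b l *
        qRacahPoly q n (α / q ^ k) β γ δ).eval (qRacahNode q γ δ x) * qRacahWeight q α β γ δ x
      = c * ∏ j ∈ Finset.range n,
        (b * q ^ l - b / q ^ k * q ^ j) * (1 - β * b * q * q ^ l * q ^ j / (b * q ^ l)) := by
  have hq := hq0.ne'
  have hb : b ≠ 0 := left_ne_zero_of_mul_eq_one hbN
  have hN : 0 < N := by lia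
  have hk := pow_ne_zero k hq
  have hβ := h.beta_ne_zero hN
  obtain ⟨K, hK, hmom⟩ := h.exists_mixedMoment_eq hq0 hq1 hN hbN hα hβ
  have hαk : α / q ^ k * q = b / q ^ k := by rw [div_mul_eq_mul_div, hα]
  obtain ⟨h2, h3, h5⟩ := h.qPoch_ne_zero hnN
  have hC := _root_.qPoch_shifted_ne_zero (k := k) hq0 hq1 hbN hnN
  have hD : qPoch (β * b * q * q ^ l) q n ≠ 0 := (qPoch_ne_zero_iff _ _ _).2 fun j hj => by
    rw [mul_assoc, ← pow_add]
    exact h.param_ne' hα (by lia)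
  have hDl : qPoch (β * b * q) q l ≠ 0 := (qPoch_ne_zero_iff _ _ _).2 fun j hj =>
    h.param_ne' hα (by lia)
  have hbl : qPoch b q l ≠ 0 := (qPoch_ne_zero_iff _ _ _).2 fun j hj =>
    mul_pow_ne_one hq0 hq1 hbN (by lia)
  have hpref : qPoch (α / q ^ k * q) q n * qPoch (β * δ * q) q n * qPoch (γ * q) q n
      / qPoch (α / q ^ k * β * q ^ (n + 1)) q n ≠ 0 := by
    rw [hαk]
    exact div_ne_zero (mul_ne_zero (mul_ne_zero hC h2) h3) (h.qPoch_shifted_ne_zero hq0 hkn hnN)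
  have hprod : ∏ j ∈ Finset.range l,
      (-(q / (b * q ^ j)) * (γ - β * (b * q ^ j)) * (δ - b * q ^ j)) ≠ 0 :=
    Finset.prod_ne_zero_iff.2 fun j hj =>
      h.shift_factor_ne_zero hq0 hbN hβ ((Finset.mem_range.1 hj).trans (by lia))
  -- Splitting (b; q)_{l+m} and (βbq; q)_{l+m} at l produces A and D, while C and E come from the
  -- shifted parameter α/q^k. The balancing condition is αq = b.
  have hsaal := qSaalschutz (q := q) (A := b * q ^ l) (C := b / q ^ k)
    (D := β * b * q * q ^ l) (E := α / q ^ k * β * q) hq (mul_ne_zero hb (pow_ne_zero l hq))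
    (by rw [← hα]; field_simp) n ((qPoch_ne_zero_iff _ _ _).1 hC)
    ((qPoch_ne_zero_iff _ _ _).1 hD) ((qPoch_ne_zero_iff _ _ _).1 h5)
  rw [Finset.prod_div_distrib, Finset.prod_mul_distrib (f := fun j => 1 - b / q ^ k * q ^ j)]
    at hsaal
  change _ = _ / (qPoch (b / q ^ k) q n * qPoch (β * b * q * q ^ l) q n) at hsaal
  set G := ∏ j ∈ Finset.range n,
    (b * q ^ l - b / q ^ k * q ^ j) * (1 - β * b * q * q ^ l * q ^ j / (b * q ^ l))
  refine ⟨_, mul_ne_zero hpref (div_ne_zero (mul_ne_zero (mul_ne_zero hK hbl) hprod)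
    (mul_ne_zero hDl (mul_ne_zero hC hD))), ?_⟩
  rw [sum_qRacahPoly_mul_qShiftBasis, mul_assoc _ _ G]
  congr 1
  have hG : K * qPoch b q l * (∏ j ∈ Finset.range l,
        (-(q / (b * q ^ j)) * (γ - β * (b * q ^ j)) * (δ - b * q ^ j)))
      / (qPoch (β * b * q) q l * (qPoch (b / q ^ k) q n * qPoch (β * b * q * q ^ l) q n)) * G
      = K * qPoch b q l * (∏ j ∈ Finset.range l,
        (-(q / (b * q ^ j)) * (γ - β * (b * q ^ j)) * (δ - b * q ^ j))) / qPoch (β * b * q) q l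
        * (G / (qPoch (b / q ^ k) q n * qPoch (β * b * q * q ^ l) q n)) := by
    rw [div_mul_div_comm, div_mul_eq_mul_div]
  rw [hG, ← hsaal, Finset.mul_sum]
  refine Finset.sum_congr rfl fun m hm => ?_
  obtain ⟨g2, g3, -⟩ := h.qPoch_ne_zero (m := m) (by rw [Finset.mem_range] at hm; lia)
  rw [hmom, qMixedClosedForm, hαk, add_comm m l, qPoch_add, qPoch_add (β * b * q),
    show α / q ^ k * β * q * q ^ n = α / q ^ k * β * q ^ (n + 1) by ring]
  generalize ∏ j ∈ Finset.range l,
    (-(q / (b * q ^ j)) * (γ - β * (b * q ^ j)) * (δ - b * q ^ j)) = p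
  generalize qPoch (β * δ * q) q m = f at *
  generalize qPoch (γ * q) q m = g at *
  simp only [div_eq_mul_inv, mul_inv]
  linear_combination K * qPoch b q l * p * (qPoch (β * b * q) q l)⁻¹ *
    (qPoch ((q ^ n)⁻¹) q m * qPoch (α * (q ^ k)⁻¹ * β * q ^ (n + 1)) q m *
      qPoch (b * q ^ l) q m * q ^ m * ((qPoch (b * (q ^ k)⁻¹) q m)⁻¹ *
      (qPoch (β * b * q * q ^ l) q m)⁻¹ * (qPoch q q m)⁻¹)) *
      (mul_inv_cancel₀ g2 * (g * g⁻¹) + mul_inv_cancel₀ g3)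

theorem QRacahAdmissible.shifted_orthogonal {q : ℝ} (hq0 : 0 < q) (hq1 : q < 1)
    {N n k : ℕ} {α β γ δ b : ℝ} (h : QRacahAdmissible q N α β γ δ) (hbN : b * q ^ N = 1)
    (hα : α * q = b) (hkn : k < n) (hnN : n ≤ N) (d : ℕ) :
    ∀ P : ℝ[X], P.degree < d → d ≤ n - k → ∑ x ∈ Finset.range (N + 1),
      (P * qRacahPoly q n (α / q ^ k) β γ δ).eval (qRacahNode q γ δ x)
        * qRacahWeight q α β γ δ x = 0 := by
  induction d with
  | zero =>
    intro P hP _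
    have : P = 0 := by simpa using hP
    simp [this]
  | succ d ih =>
    intro P hP hd
    -- Subtracting the leading multiple of the monic ψ_d lowers the degree, leaving only the moment
    -- against ψ_d.
    have hR : (P - C (P.coeff d) * qShiftBasis q (γ * δ * q) b d).degree < d := by
      rw [degree_lt_iff_coeff_zero]
      intro i hi
      rw [coeff_sub, coeff_C_mul]
      rcases hi.eq_or_lt with rfl | hi
      · have := (qShiftBasis_monic q (γ * δ * q) b d).coeff_natDegree
        rw [qShiftBasis_natDegree] at this
        rw [this, mul_one, sub_self]
      · rw [coeff_eq_zero_of_natDegree_lt (p := qShiftBasis _ _ _ _)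
          (by rwa [qShiftBasis_natDegree]),
          coeff_eq_zero_of_degree_lt (hP.trans_le (by exact_mod_cast hi))]
        ring
    have h1 := ih _ hR (by lia)
    obtain ⟨c, -, hc⟩ := h.exists_shifted_moment_eq hq0 hq1 hbN hα hkn hnN (l := d) (by lia)
    -- The factor j = d + k is in range exactly because d < n - k.
    rw [Finset.prod_eq_zero (i := d + k) (Finset.mem_range.2 (by lia)), mul_zero] at hc
    · simp only [sub_mul, eval_sub, mul_assoc (C (P.coeff d)), eval_C_mul,
        Finset.sum_sub_distrib] at h1
      simp only [mul_assoc (P.coeff d)] at h1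
      rw [← Finset.mul_sum, hc, mul_zero, sub_zero] at h1
      exact h1
    · have := pow_ne_zero k hq0.ne'
      rw [pow_add]
      field_simp
      simp

theorem QRacahAdmissible.shifted_moment_ne_zero {q : ℝ} (hq0 : 0 < q) (hq1 : q < 1)
    {N n k : ℕ} {α β γ δ b : ℝ} (h : QRacahAdmissible q N α β γ δ) (hbN : b * q ^ N = 1)
    (hα : α * q = b) (hk : 1 ≤ k) (hkn : k < n) (hnN : n ≤ N) (hβn : β * q ^ n ≠ 1) :
    ∑ x ∈ Finset.range (N + 1),
      (qShiftBasis q (γ * δ * q) b (n - k) * qRacahPoly q n (α / q ^ k) β γ δ).eval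
        (qRacahNode q γ δ x) * qRacahWeight q α β γ δ x ≠ 0 := by
  obtain ⟨c, hc0, hc⟩ := h.exists_shifted_moment_eq hq0 hq1 hbN hα hkn hnN (l := n - k) (by lia)
  have hb : b ≠ 0 := left_ne_zero_of_mul_eq_one hbN
  have hqk := pow_ne_zero k hq0.ne'
  rw [hc]
  refine mul_ne_zero hc0 (Finset.prod_ne_zero_iff.2 fun j hj => ?_)
  rw [Finset.mem_range] at hj
  refine mul_ne_zero ?_ ?_
  · rw [div_mul_eq_mul_div, sub_ne_zero, Ne, eq_div_iff hqk, mul_assoc, ← pow_add,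
      Nat.sub_add_cancel hkn.le]
    intro h0
    exact hj.ne' (pow_right_injective₀ hq0 hq1.ne (mul_left_cancel₀ hb h0))
  · have e : β * b * q * q ^ (n - k) * q ^ j / (b * q ^ (n - k)) = β * q ^ (j + 1) := by
      have := pow_ne_zero (n - k) hq0.ne'
      rw [pow_succ]
      field_simp
    rw [e, sub_ne_zero, ne_comm]
    -- For j + 1 = n this is the extra hypothesis. Otherwise βq^{j+1} = αβ q^{N+j+2}, an exponent at
    -- most 2N since j + 2 ≤ n ≤ N.
    rcases (Nat.succ_le_of_lt hj).eq_or_lt with hjn | hjn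
    · rwa [show j + 1 = n from hjn]
    · convert h.param_ne (N + 1 + (j + 1)) (by lia) (by lia) using 1
      rw [pow_add, pow_succ]
      linear_combination (-(β * q ^ (j + 1))) * (q ^ N * hα + hbN)

/-! ### Conclusion in case (i), and the symmetry giving case (ii) -/

/-- The claims for a first parameter `α = q^{-N-1}`. -/
theorem QRacahAdmissible.shifted_main {q : ℝ} (hq0 : 0 < q) (hq1 : q < 1) {N n k : ℕ}
    (hk : 1 ≤ k) (hkn : k < n) (hnN : n ≤ N) {α β γ δ : ℝ} (hα : α = q ^ (-(N : ℤ) - 1))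
    (h : QRacahAdmissible q N α β γ δ) :
    IsWeakQuasiOrthogonal N (qRacahNode q γ δ) (qRacahWeight q α β γ δ) n k
        (qRacahPoly q n (α / q ^ k) β γ δ) ∧
      (β * q ^ n ≠ 1 →
        IsDiscreteQuasiOrthogonal N (qRacahNode q γ δ) (qRacahWeight q α β γ δ) n k
          (qRacahPoly q n (α / q ^ k) β γ δ)) ∧
      (QRacahPositive q N α β γ δ →
        n - k ≤ numZerosIoo (qRacahPoly q n (α / q ^ k) β γ δ)
          (qRacahNode q γ δ 0) (qRacahNode q γ δ N)) := by
  obtain ⟨b, hb⟩ : ∃ b, α * q = b := ⟨_, rfl⟩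
  have hbN : b * q ^ N = 1 := by
    rw [← hb, hα, zpow_sub_one₀ hq0.ne', inv_mul_cancel_right₀ hq0.ne', zpow_neg, zpow_natCast,
      inv_mul_cancel₀ (pow_ne_zero N hq0.ne')]
  have hdeg := h.natDegree_shifted hq0 hq1 hbN hb hkn hnN
  have horth := h.shifted_orthogonal hq0 hq1 hbN hb hkn hnN
  have hmoment : ∀ m, discreteMoment N (qRacahNode q γ δ) (qRacahWeight q α β γ δ)
      (qRacahPoly q n (α / q ^ k) β γ δ) m = ∑ x ∈ Finset.range (N + 1),
      (X ^ m * qRacahPoly q n (α / q ^ k) β γ δ).eval (qRacahNode q γ δ x)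
        * qRacahWeight q α β γ δ x := fun m => by
    simp [discreteMoment]
  have hweak : IsWeakQuasiOrthogonal N (qRacahNode q γ δ) (qRacahWeight q α β γ δ) n k
      (qRacahPoly q n (α / q ^ k) β γ δ) := by
    refine ⟨hdeg, fun m hm => ?_⟩
    rw [hmoment]
    refine horth (m + 1) _ ?_ (by lia)
    rw [degree_X_pow]
    exact_mod_cast m.lt_succ_self
  refine ⟨hweak, fun hβ => ⟨hweak, hkn.le, ?_⟩, fun hpos => ?_⟩
  · have hne := h.shifted_moment_ne_zero hq0 hq1 hbN hb hk hkn hnN hβ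
    -- Both polynomials are monic of degree n - k, so their difference is orthogonal to Q and the
    -- two moments coincide.
    have hdiff : (X ^ (n - k) - qShiftBasis q (γ * δ * q) b (n - k)).degree
        < ((n - k : ℕ) : WithBot ℕ) := by
      have := degree_sub_lt_left (p := (X ^ (n - k) : ℝ[X]))
        (q := qShiftBasis q (γ * δ * q) b (n - k)) ?_ (pow_ne_zero _ X_ne_zero) ?_
      · rwa [degree_X_pow] at this
      · rw [degree_X_pow, degree_eq_natDegree (qShiftBasis_monic _ _ _ _).ne_zero,
          qShiftBasis_natDegree]
      · rw [(qShiftBasis_monic _ _ _ _).leadingCoeff, (monic_X_pow _).leadingCoeff]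
    have h0 := horth (n - k) _ hdiff le_rfl
    simp only [sub_mul, eval_sub, Finset.sum_sub_distrib] at h0
    rw [hmoment, sub_eq_zero.1 h0]
    exact hne
  · refine le_numZerosIoo_of_orthogonal (by lia) (fun h0 => ?_) (hdeg.le.trans hnN)
      hpos.node_lt hpos.weight_pos fun P hP => horth (n - k) P hP le_rfl
    rw [h0, natDegree_zero] at hdeg
    lia

/-- The `q`-Racah weight is invariant under `(α, βδ) ↦ (βδ, α)`. -/
theorem qRacahWeight_symm (q α β γ : ℝ) {δ : ℝ} (hδ : δ ≠ 0) :
    qRacahWeight q (β * δ) (α / δ) γ δ = qRacahWeight q α β γ δ := by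
  funext x
  unfold qRacahWeight
  rw [div_mul_cancel₀ α hδ, show β * δ * (α / δ) = α * β by field_simp,
    show γ * δ * q / (β * δ) = γ * q / β by
      rw [mul_right_comm, mul_div_mul_right _ _ hδ],
    show γ * q / (α / δ) = γ * δ * q / α by rw [div_div_eq_mul_div, mul_right_comm]]
  ring

/-- The monic `q`-Racah polynomial is invariant under `(α, βδ) ↦ (βδ, α)`. -/
theorem qRacahPoly_symm (q : ℝ) (n : ℕ) (α β γ : ℝ) {δ : ℝ} (hδ : δ ≠ 0) :
    qRacahPoly q n (β * δ) (α / δ) γ δ = qRacahPoly q n α β γ δ := by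
  unfold qRacahPoly
  rw [div_mul_cancel₀ α hδ, show β * δ * (α / δ) = α * β by field_simp,
    mul_comm (qPoch (β * δ * q) q n)]
  congr 1
  refine Finset.sum_congr rfl fun m _ => ?_
  rw [mul_comm (qPoch (β * δ * q) q m)]

theorem theorem3p3 (q : ℝ) (hq0 : 0 < q) (hq1 : q < 1) (N n k : ℕ)
    (hk : 1 ≤ k) (hkn : k ≤ n - 1) (hnN : n ≤ N) :
    (∀ α β γ δ : ℝ, α = q ^ (-(N : ℤ) - 1) → QRacahAdmissible q N α β γ δ →
      IsWeakQuasiOrthogonal N (qRacahNode q γ δ) (qRacahWeight q α β γ δ) n k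
          (qRacahPoly q n (α / q ^ k) β γ δ) ∧
      (β * q ^ n ≠ 1 →
        IsDiscreteQuasiOrthogonal N (qRacahNode q γ δ) (qRacahWeight q α β γ δ) n k
          (qRacahPoly q n (α / q ^ k) β γ δ)) ∧
      (QRacahPositive q N α β γ δ →
        n - k ≤ numZerosIoo (qRacahPoly q n (α / q ^ k) β γ δ)
          (qRacahNode q γ δ 0) (qRacahNode q γ δ N))) ∧
    (∀ α β γ δ : ℝ, δ ≠ 0 → β = q ^ (-(N : ℤ) - 1) / δ → QRacahAdmissible q N α β γ δ →
      IsWeakQuasiOrthogonal N (qRacahNode q γ δ) (qRacahWeight q α β γ δ) n k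
          (qRacahPoly q n α (β / q ^ k) γ δ) ∧
      (α * q ^ n ≠ δ →
        IsDiscreteQuasiOrthogonal N (qRacahNode q γ δ) (qRacahWeight q α β γ δ) n k
          (qRacahPoly q n α (β / q ^ k) γ δ)) ∧
      (QRacahPositive q N α β γ δ →
        n - k ≤ numZerosIoo (qRacahPoly q n α (β / q ^ k) γ δ)
          (qRacahNode q γ δ 0) (qRacahNode q γ δ N))) := by
  have hkn' : k < n := by lia
  refine ⟨fun α β γ δ hα h => h.shifted_main hq0 hq1 hk hkn' hnN hα, ?_⟩
  intro α β γ δ hδ hβ h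
  have hw := qRacahWeight_symm q α β γ hδ
  -- Under the symmetry, shifting β becomes shifting the first parameter βδ = q^{-N-1}.
  have hP : qRacahPoly q n (β * δ / q ^ k) (α / δ) γ δ = qRacahPoly q n α (β / q ^ k) γ δ := by
    rw [← qRacahPoly_symm q n α (β / q ^ k) γ hδ, div_mul_eq_mul_div]
  have h' : QRacahAdmissible q N (β * δ) (α / δ) γ δ := by
    refine ⟨h.node_injOn, fun x hx => ?_, fun j hj hjN => ?_⟩
    · rw [hw]
      exact h.weight_ne_zero x hx
    · rw [show β * δ * (α / δ) = α * β by field_simp]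
      exact h.param_ne j hj hjN
  obtain ⟨c1, c2, c3⟩ := h'.shifted_main hq0 hq1 hk hkn' hnN (by rw [hβ, div_mul_cancel₀ _ hδ])
  rw [hw, hP] at c1 c2
  rw [hP] at c3
  refine ⟨c1, fun hα => c2 fun h0 => hα ?_, fun hpos => c3 ⟨fun x hx => ?_, hpos.node_lt⟩⟩
  · rwa [div_mul_eq_mul_div, div_eq_one_iff_eq hδ] at h0
  · rw [hw]
    exact hpos.weight_pos x hx
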